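/- Fix a positive integer $\Delta$. All graphs are simple, undirected, countable and have at least one vertex. Let $\mathbf{Gr}$ be the set of isomorphism classes $[X,x]$ of countable connected rooted graphs $(X,x)$ in which every vertex has degree at most $\Delta$, with the metric $\rho([X,x],[Y,y]) = 0$ if $[X,x]=[Y,y]$ and $\rho([X,x],[Y,y]) = 2^{-r}$ otherwise, where $r = \sup\{s \in \mathbb{N} : [B_X(x,s),x] = [B_Y(y,s),y]\}$ and $B_X(x,s)$ is the subgraph of $X$ induced by the vertices at distance at most $s$ from $x$; $\mathbf{Gr}$ carries the Borel $\sigma$-algebra. For a finite graph $X$ with all degrees at most $\Delta$, let $X_x$ be the connected component of $X$ containing the vertex $x$, let $\mathrm{Aut}(X)x$ be the orbit of $x$ under the automorphism group of $X$, and let the law $\Psi(X)$ be the probability measure on $\mathbf{Gr}$ concentrated on $\{[X_x,x] : x \in V(X)\}$ with $\Psi(X)\{[X_x,x]\} = |\mathrm{Aut}(X)x|/|V(X)|$ for all $x \in V(X)$. **Theorem.** Let $(X_n)$ be a sequence of finite graphs with all vertex degrees at most $\Delta$, and let $G_n$ be a subgraph of $X_n$ for every $n$, such that $\lim_{n\to\infty}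 |V(G_n)|/|V(X_n)| = 0$. Let $X_n \setminus G_n$ be the subgraph of $X_n$ induced by $V(X_n) \setminus V(G_n)$ (it is nonempty for all large $n$; for the finitely many other $n$ put $\Psi(X_n \setminus G_n) = 0$). Then $$\lim_{n \to \infty} \left|\int f \, d\Psi(X_n) - \int f \, d\Psi(X_n \setminus G_n)\right| = 0$$ for every bounded continuous function $f : \mathbf{Gr} \to \mathbb{R}$. Furthermore, for every Borel probability measure $\mu$ on $\mathbf{Gr}$, the sequence $(\Psi(X_n))$ converges weakly to $\mu$ (that is, $\int f \, d\Psi(X_n) \to \int f \, d\mu$ for every bounded continuous $f : \mathbf{Gr} \to \mathbb{R}$) if and only if $(\Psi(X_n \setminus G_n))$ converges weakly to $\mu$. -/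

import Mathlib

open Filter Topology MeasureTheory

universe u

namespace GraphLaw

/-- Every vertex of `G` has at most `Δ` neighbours. -/
def DegreeBounded {V : Type u} (Δ : ℕ) (G : SimpleGraph V) : Prop :=
  ∀ v, (G.neighborSet v).encard ≤ Δ

theorem DegreeBounded.induce {V : Type u} {Δ : ℕ} {G : SimpleGraph V}
    (h : DegreeBounded Δ G) (A : Set V) : DegreeBounded Δ (G.induce A) := by
  intro v
  refine le_trans ?_ (h v)
  rw [← (Subtype.val_injective (p := (· ∈ A))).encard_image]
  refine Set.encard_le_encard ?_
  rintro _ ⟨w, hw, rfl⟩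
  exact hw

/-- The rooted graphs `(G, x)` and `(H, y)` are isomorphic, i.e. `[G, x] = [H, y]`. -/
def RootedIso {V W : Type u} (G : SimpleGraph V) (x : V) (H : SimpleGraph W) (y : W) : Prop :=
  ∃ φ : G ≃g H, φ x = y

/-- The vertex set of the closed ball `B_G(x, r)`. -/
def ball {V : Type u} (G : SimpleGraph V) (x : V) (r : ℕ) : Set V :=
  {y | G.edist x y ≤ r}

theorem root_mem_ball {V : Type u} (G : SimpleGraph V) (x : V) (r : ℕ) : x ∈ ball G x r := by
  simp [ball]

/-- `[B_G(x, r), x] = [B_H(y, r), y]`, where the balls are regarded as induced subgraphs. -/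
def BallIso {V W : Type u} (G : SimpleGraph V) (x : V) (H : SimpleGraph W) (y : W) (r : ℕ) :
    Prop :=
  RootedIso (G.induce (ball G x r)) ⟨x, root_mem_ball G x r⟩
    (H.induce (ball H y r)) ⟨y, root_mem_ball H y r⟩

/-- Countable connected rooted graphs whose vertex degrees are at most `Δ`. -/
structure RootedGraph (Δ : ℕ) : Type (u + 1) where
  V : Type u
  countable : Countable V
  graph : SimpleGraph V
  root : V
  connected : graph.Connected
  degree_le : DegreeBounded Δ graph

instance rootedSetoid (Δ : ℕ) : Setoid (RootedGraph.{u} Δ) where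
  r X Y := RootedIso X.graph X.root Y.graph Y.root
  iseqv :=
    { refl := fun X => ⟨SimpleGraph.Iso.refl, rfl⟩
      symm := fun {X Y} ⟨φ, h⟩ => ⟨φ.symm, by rw [← h]; exact φ.symm_apply_apply _⟩
      trans := fun {X Y Z} ⟨φ, h⟩ ⟨ψ, k⟩ => ⟨φ.trans ψ, by rw [← k, ← h]; rfl⟩ }

/-- The space `Gr` of isomorphism classes `[X, x]` of countable connected rooted graphs with
vertex degrees at most `Δ`. -/
def Gr (Δ : ℕ) : Type (u + 1) := Quotient (rootedSetoid.{u} Δ)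

section Balls

variable {V W : Type u} {G : SimpleGraph V} {H : SimpleGraph W} {x : V} {y : W}

theorem mem_ball_iff {r : ℕ} {v : V} :
    v ∈ ball G x r ↔ ∃ p : G.Walk x v, p.length ≤ r := by
  constructor
  · intro h
    have h' : G.edist x v ≤ r := h
    obtain ⟨p, hp⟩ := SimpleGraph.exists_walk_of_edist_ne_top
      (ne_top_of_le_ne_top (ENat.natCast_ne_top r) h')
    refine ⟨p, ?_⟩
    rw [← hp] at h'
    exact_mod_cast h'
  · rintro ⟨p, hp⟩
    exact le_trans p.edist_le (by exact_mod_cast hp)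

theorem ball_mono {r s : ℕ} (h : r ≤ s) : ball G x r ⊆ ball G x s :=
  fun _ hv => le_trans (show G.edist x _ ≤ r from hv) (by exact_mod_cast h)

theorem ball_iso_mem {r s : ℕ} (hrs : r ≤ s)
    (φ : G.induce (ball G x s) ≃g H.induce (ball H y s))
    (hφ : φ ⟨x, root_mem_ball G x s⟩ = ⟨y, root_mem_ball H y s⟩)
    {v : V} (hv : v ∈ ball G x r) : (φ ⟨v, ball_mono hrs hv⟩).1 ∈ ball H y r := by
  classical
  obtain ⟨p, hp⟩ := mem_ball_iff.1 hv
  have hs : ∀ w ∈ p.support, w ∈ ball G x s := fun w hw =>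
    mem_ball_iff.2 ⟨p.takeUntil w hw, (p.length_takeUntil_le_length hw).trans (hp.trans hrs)⟩
  obtain ⟨q, hq⟩ : ∃ q : (G.induce (ball G x s)).Walk ⟨x, root_mem_ball G x s⟩
      ⟨v, ball_mono hrs hv⟩, q.length = p.length := by
    refine ⟨p.induce _ hs, ?_⟩
    have := congrArg SimpleGraph.Walk.length (p.map_induce hs)
    rwa [SimpleGraph.Walk.length_map] at this
  let q' := (q.map φ.toHom).map
    (SimpleGraph.Embedding.induce (G := H) (ball H y s)).toHom
  have hq' : q'.length = p.length := by
    rw [← hq]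
    exact (SimpleGraph.Walk.length_map _ _).trans (SimpleGraph.Walk.length_map _ _)
  have h1 : (φ ⟨x, root_mem_ball G x s⟩).1 = y := congrArg Subtype.val hφ
  have h2 : ∀ {z : W}, z = y → (∃ q : H.Walk z (φ ⟨v, ball_mono hrs hv⟩).1, q.length ≤ r) →
      (φ ⟨v, ball_mono hrs hv⟩).1 ∈ ball H y r := by
    rintro z rfl h
    exact mem_ball_iff.2 h
  exact h2 h1 ⟨q', hq'.le.trans hp⟩

theorem symm_root {r : ℕ} (φ : G.induce (ball G x r) ≃g H.induce (ball H y r))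
    (hφ : φ ⟨x, root_mem_ball G x r⟩ = ⟨y, root_mem_ball H y r⟩) :
    φ.symm ⟨y, root_mem_ball H y r⟩ = ⟨x, root_mem_ball G x r⟩ := by
  rw [← hφ]; exact φ.symm_apply_apply _

theorem BallIso.mono {r s : ℕ} (hrs : r ≤ s) (h : BallIso G x H y s) : BallIso G x H y r := by
  obtain ⟨φ, hφ⟩ := h
  refine ⟨⟨⟨fun v => ⟨_, ball_iso_mem hrs φ hφ v.2⟩,
    fun w => ⟨_, ball_iso_mem hrs φ.symm (symm_root φ hφ) w.2⟩, ?_, ?_⟩, ?_⟩, ?_⟩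
  · intro v
    have e := congrArg Subtype.val (φ.symm_apply_apply ⟨v.1, ball_mono hrs v.2⟩)
    exact Subtype.ext e
  · intro w
    have e := congrArg Subtype.val (φ.apply_symm_apply ⟨w.1, ball_mono hrs w.2⟩)
    exact Subtype.ext e
  · intro v w
    exact φ.map_adj_iff (v := ⟨v.1, ball_mono hrs v.2⟩) (w := ⟨w.1, ball_mono hrs w.2⟩)
  · have e := congrArg Subtype.val hφ
    exact Subtype.ext e

theorem RootedIso.symm (h : RootedIso G x H y) : RootedIso H y G x := by
  obtain ⟨φ, rfl⟩ := h
  exact ⟨φ.symm, φ.symm_apply_apply _⟩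

theorem RootedIso.trans {U : Type u} {K : SimpleGraph U} {z : U} (h : RootedIso G x H y)
    (k : RootedIso H y K z) : RootedIso G x K z := by
  obtain ⟨φ, rfl⟩ := h
  obtain ⟨ψ, rfl⟩ := k
  exact ⟨φ.trans ψ, rfl⟩

theorem RootedIso.ballIso (h : RootedIso G x H y) (r : ℕ) : BallIso G x H y r := by
  obtain ⟨φ, rfl⟩ := h
  have key : ∀ v, v ∈ ball G x r ↔ φ v ∈ ball H (φ x) r := by
    intro v
    rw [mem_ball_iff, mem_ball_iff]
    constructor
    · rintro ⟨p, hp⟩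
      exact ⟨p.map φ.toHom, by simpa using hp⟩
    · rintro ⟨p, hp⟩
      exact ⟨(p.map φ.symm.toHom).copy (φ.symm_apply_apply x) (φ.symm_apply_apply v),
        by simpa using hp⟩
  refine ⟨⟨φ.toEquiv.subtypeEquiv key, ?_⟩, rfl⟩
  intro v w
  exact φ.map_adj_iff

theorem ball_finite {Δ : ℕ} (hG : DegreeBounded Δ G) (r : ℕ) : (ball G x r).Finite := by
  induction r with
  | zero =>
    refine (Set.finite_singleton x).subset fun v hv => ?_
    have h : G.edist x v ≤ ((0 : ℕ) : ℕ∞) := hv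
    have h0 : G.edist x v = 0 := by simpa using h
    exact (SimpleGraph.edist_eq_zero_iff.1 h0).symm
  | succ r ih =>
    have hfin : (⋃ w ∈ ball G x r, G.neighborSet w).Finite := ih.biUnion fun w _ =>
      Set.encard_ne_top_iff.1 (ne_top_of_le_ne_top (ENat.natCast_ne_top Δ) (hG w))
    refine (ih.union hfin).subset fun v hv => ?_
    obtain ⟨p, hp⟩ := mem_ball_iff.1 hv
    obtain ⟨q, hq⟩ : ∃ q : G.Walk v x, q.length ≤ r + 1 := ⟨p.reverse, by simpa using hp⟩
    cases q with
    | nil => exact Or.inl (root_mem_ball G x r)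
    | @cons _ w _ hvw q =>
      refine Or.inr (Set.mem_biUnion (x := w) ?_ hvw.symm)
      refine mem_ball_iff.2 ⟨q.reverse, ?_⟩
      simpa using hq

/-- Locally finite connected rooted graphs with isomorphic balls of all radii are isomorphic. -/
theorem rootedIso_of_ballIso {Δ : ℕ} (hG : DegreeBounded Δ G) (hH : DegreeBounded Δ H)
    (cG : G.Connected) (cH : H.Connected) (h : ∀ r, BallIso G x H y r) : RootedIso G x H y := by
  choose φ hφ using h
  let U : Ultrafilter ℕ := hyperfilter ℕ
  have hge : ∀ r : ℕ, ∀ᶠ s in (U : Filter ℕ), r ≤ s := fun r =>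
    Nat.hyperfilter_le_atTop (eventually_ge_atTop r)
  let R : ℕ → V → W → Prop := fun s v w =>
    ∃ (hv : v ∈ ball G x s) (hw : w ∈ ball H y s), φ s ⟨v, hv⟩ = ⟨w, hw⟩
  have hf : ∀ {s v w w'}, R s v w → R s v w' → w = w' := by
    rintro s v w w' ⟨hv, hw, e⟩ ⟨hv', hw', e'⟩
    exact congrArg Subtype.val (e.symm.trans e')
  have hi : ∀ {s v v' w}, R s v w → R s v' w → v = v' := by
    rintro s v v' w ⟨hv, hw, e⟩ ⟨hv', hw', e'⟩
    exact congrArg Subtype.val ((φ s).injective (e.trans e'.symm))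
  have hadj : ∀ {s v v' w w'}, R s v w → R s v' w' → (H.Adj w w' ↔ G.Adj v v') := by
    rintro s v v' w w' ⟨hv, hw, e⟩ ⟨hv', hw', e'⟩
    have := (φ s).map_adj_iff (v := ⟨v, hv⟩) (w := ⟨v', hv'⟩)
    rw [e, e'] at this
    simpa using this
  have hA : ∀ v, ∃ w, ∀ᶠ s in (U : Filter ℕ), R s v w := by
    intro v
    obtain ⟨p⟩ := cG.preconnected x v
    have hv : v ∈ ball G x p.length := mem_ball_iff.2 ⟨p, le_rfl⟩
    have hex : ∀ᶠ s in (U : Filter ℕ), ∃ w ∈ ball H y p.length, R s v w := by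
      filter_upwards [hge p.length] with s hs
      exact ⟨_, ball_iso_mem hs (φ s) (hφ s) hv, ball_mono hs hv, Subtype.prop _, rfl⟩
    obtain ⟨w, -, hw⟩ := (Ultrafilter.eventually_exists_mem_iff (ball_finite hH _)).1 hex
    exact ⟨w, hw⟩
  have hB : ∀ w, ∃ v, ∀ᶠ s in (U : Filter ℕ), R s v w := by
    intro w
    obtain ⟨p⟩ := cH.preconnected y w
    have hw : w ∈ ball H y p.length := mem_ball_iff.2 ⟨p, le_rfl⟩
    have hex : ∀ᶠ s in (U : Filter ℕ), ∃ v ∈ ball G x p.length, R s v w := by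
      filter_upwards [hge p.length] with s hs
      exact ⟨_, ball_iso_mem hs (φ s).symm (symm_root (φ s) (hφ s)) hw, Subtype.prop _,
        ball_mono hs hw, (φ s).apply_symm_apply _⟩
    obtain ⟨v, -, hv⟩ := (Ultrafilter.eventually_exists_mem_iff (ball_finite hG _)).1 hex
    exact ⟨v, hv⟩
  choose f hfR using hA
  choose g hgR using hB
  refine ⟨⟨⟨f, g, ?_, ?_⟩, ?_⟩, ?_⟩
  · intro v
    obtain ⟨s, h1, h2⟩ := ((hfR v).and (hgR (f v))).exists
    exact hi h2 h1
  · intro w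
    obtain ⟨s, h1, h2⟩ := ((hfR (g w)).and (hgR w)).exists
    exact hf h1 h2
  · intro v v'
    obtain ⟨s, h1, h2⟩ := ((hfR v).and (hfR v')).exists
    exact hadj h1 h2
  · obtain ⟨s, h1⟩ := (hfR x).exists
    exact hf h1 ⟨root_mem_ball G x s, root_mem_ball H y s, hφ s⟩

end Balls

variable {Δ : ℕ}

/-- The elements `[X, x]` and `[Y, y]` of `Gr` satisfy `[B_X(x, r), x] = [B_Y(y, r), y]`. -/
def Gr.Agree (a b : Gr.{u} Δ) (r : ℕ) : Prop :=
  Quotient.liftOn₂ a b (fun X Y => BallIso X.graph X.root Y.graph Y.root r)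
    (fun _ _ _ _ h k => propext
      ⟨fun e => ((h.ballIso r).symm.trans e).trans (k.ballIso r),
        fun e => ((h.ballIso r).trans e).trans (k.ballIso r).symm⟩)

theorem Gr.Agree.symm {a b : Gr.{u} Δ} {r : ℕ} (h : a.Agree b r) : b.Agree a r := by
  induction a using Quotient.inductionOn
  induction b using Quotient.inductionOn
  exact RootedIso.symm h

theorem Gr.Agree.trans {a b c : Gr.{u} Δ} {r : ℕ} (h : a.Agree b r) (k : b.Agree c r) :
    a.Agree c r := by
  induction a using Quotient.inductionOn
  induction b using Quotient.inductionOn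
  induction c using Quotient.inductionOn
  exact RootedIso.trans h k

theorem Gr.Agree.mono {a b : Gr.{u} Δ} {r s : ℕ} (hrs : r ≤ s) (h : a.Agree b s) :
    a.Agree b r := by
  induction a using Quotient.inductionOn
  induction b using Quotient.inductionOn
  exact BallIso.mono hrs h

theorem Gr.agree_zero (a b : Gr.{u} Δ) : a.Agree b 0 := by
  induction a using Quotient.inductionOn with | h X =>
  induction b using Quotient.inductionOn with | h Y =>
  have hX : ∀ {V : Type u} (G : SimpleGraph V) (x : V) (v : ball G x 0),
      v = ⟨x, root_mem_ball G x 0⟩ := by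
    intro V G x v
    have h : G.edist x v ≤ ((0 : ℕ) : ℕ∞) := v.2
    have h0 : G.edist x v = 0 := by simpa using h
    exact Subtype.ext (SimpleGraph.edist_eq_zero_iff.1 h0).symm
  refine ⟨⟨⟨fun _ => ⟨_, root_mem_ball _ _ 0⟩, fun _ => ⟨_, root_mem_ball _ _ 0⟩,
    fun v => (hX _ _ v).symm, fun v => (hX _ _ v).symm⟩, ?_⟩, rfl⟩
  intro v w
  rw [hX _ _ v, hX _ _ w]
  simp

theorem Gr.eq_of_agree {a b : Gr.{u} Δ} (h : ∀ r, a.Agree b r) : a = b := by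
  induction a using Quotient.inductionOn with | h X =>
  induction b using Quotient.inductionOn with | h Y =>
  exact Quotient.sound (rootedIso_of_ballIso X.degree_le Y.degree_le X.connected Y.connected h)

theorem Gr.bddAbove_agree {a b : Gr.{u} Δ} (h : a ≠ b) : BddAbove {s | a.Agree b s} := by
  by_contra hb
  rw [not_bddAbove_iff] at hb
  refine h (Gr.eq_of_agree fun r => ?_)
  obtain ⟨s, hs, hrs⟩ := hb r
  exact Gr.Agree.mono hrs.le hs

open scoped Classical in
/-- The metric `ρ` on `Gr`: two distinct classes have distance `2 ^ (-r)`, where `r` is the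
largest radius for which the balls around the roots are isomorphic as rooted graphs. -/
noncomputable def Gr.rho (a b : Gr.{u} Δ) : ℝ :=
  if a = b then 0 else (2 : ℝ) ^ (-((sSup {s : ℕ | a.Agree b s} : ℕ) : ℤ))

theorem Gr.rho_self (a : Gr.{u} Δ) : a.rho a = 0 := by simp [Gr.rho]

theorem Gr.rho_nonneg (a b : Gr.{u} Δ) : 0 ≤ a.rho b := by
  unfold Gr.rho; split_ifs <;> positivity

theorem Gr.eq_of_rho_eq_zero {a b : Gr.{u} Δ} (h : a.rho b = 0) : a = b := by
  by_contra hne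
  rw [Gr.rho, if_neg hne] at h
  have : (0 : ℝ) < (2 : ℝ) ^ (-((sSup {s : ℕ | a.Agree b s} : ℕ) : ℤ)) := by positivity
  exact this.ne' h

theorem Gr.rho_comm (a b : Gr.{u} Δ) : a.rho b = b.rho a := by
  have : {s | a.Agree b s} = {s | b.Agree a s} := by
    ext s; exact ⟨Gr.Agree.symm, Gr.Agree.symm⟩
  unfold Gr.rho
  rw [this]
  by_cases h : a = b
  · simp [h]
  · simp [h, Ne.symm h]

theorem Gr.rho_ultra (a b c : Gr.{u} Δ) : a.rho c ≤ max (a.rho b) (b.rho c) := by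
  by_cases hab : a = b
  · subst hab; exact le_max_right _ _
  by_cases hbc : b = c
  · subst hbc; exact le_max_left _ _
  by_cases hac : a = c
  · subst hac; rw [Gr.rho_self]; exact le_max_of_le_left (Gr.rho_nonneg _ _)
  have h1 : a.Agree b (sSup {s | a.Agree b s}) :=
    Nat.sSup_mem ⟨0, Gr.agree_zero a b⟩ (Gr.bddAbove_agree hab)
  have h2 : b.Agree c (sSup {s | b.Agree c s}) :=
    Nat.sSup_mem ⟨0, Gr.agree_zero b c⟩ (Gr.bddAbove_agree hbc)
  have key : ∀ {r}, a.Agree c r → r ≤ sSup {s | a.Agree c s} := fun h =>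
    le_csSup (Gr.bddAbove_agree hac) h
  unfold Gr.rho
  rw [if_neg hab, if_neg hbc, if_neg hac]
  rcases le_total (sSup {s | a.Agree b s}) (sSup {s | b.Agree c s}) with h | h
  · refine le_max_of_le_left (zpow_le_zpow_right₀ one_le_two ?_)
    have := key (h1.trans (h2.mono h))
    omega
  · refine le_max_of_le_right (zpow_le_zpow_right₀ one_le_two ?_)
    have := key ((h1.mono h).trans h2)
    omega

noncomputable instance Gr.metricSpace : MetricSpace (Gr.{u} Δ) where
  dist := Gr.rho
  dist_self := Gr.rho_self
  dist_comm := Gr.rho_comm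
  dist_triangle a b c := (Gr.rho_ultra a b c).trans
    (max_le_add_of_nonneg (Gr.rho_nonneg _ _) (Gr.rho_nonneg _ _))
  eq_of_dist_eq_zero := Gr.eq_of_rho_eq_zero

noncomputable instance Gr.measurableSpace : MeasurableSpace (Gr.{u} Δ) := borel _

instance Gr.borelSpace : BorelSpace (Gr.{u} Δ) := ⟨rfl⟩

section Law

variable {V : Type u} {X : SimpleGraph V}

/-- The rooted graph `(X_x, x)`, where `X_x` is the connected component of `x` in `X`. -/
def component [Countable V] (hX : DegreeBounded Δ X) (x : V) : RootedGraph.{u} Δ where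
  V := (X.connectedComponentMk x).supp
  countable := inferInstance
  graph := X.induce (X.connectedComponentMk x).supp
  root := ⟨x, rfl⟩
  connected := (X.connectedComponentMk x).connected_toSimpleGraph
  degree_le := hX.induce _

/-- The rooted connected component `[X_x, x]` of `X`. -/
def rootedComponent [Countable V] (hX : DegreeBounded Δ X) (x : V) : Gr.{u} Δ :=
  Quotient.mk _ (component hX x)

/-- The set `Rcc(X)` of rooted connected components of `X`. -/
def Rcc [Countable V] (hX : DegreeBounded Δ X) : Set (Gr.{u} Δ) :=
  Set.range (rootedComponent hX)

/-- The orbit `Aut(X)x` of the vertex `x` under the automorphism group of `X`. -/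
def autOrbit (X : SimpleGraph V) (x : V) : Set V := {y | ∃ φ : X ≃g X, φ x = y}

/-- The law `Ψ(X)` of a finite graph `X`: the measure on `Gr` that is concentrated on `Rcc(X)` and
gives the atom `[X_x, x]` the mass `|Aut(X)x| / |V(X)|`. The mass does not depend on the vertex `x`
that represents the atom: see `law_singleton`. If `X` has no vertices, this is the zero measure. -/
noncomputable def law [Finite V] (hX : DegreeBounded Δ X) : Measure (Gr.{u} Δ) :=
  Measure.sum fun c : Rcc hX =>
    (((autOrbit X c.2.choose).ncard : ENNReal) / (Nat.card V : ENNReal)) • Measure.dirac c.1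

section Extension

open scoped Classical in
/-- Extends an isomorphism between the subgraphs induced by `A` and `B` to all vertices. -/
noncomputable def extend (A B : Set V) (φ : X.induce A ≃g X.induce B) (z : V) : V :=
  if h : z ∈ A then φ ⟨z, h⟩ else if h : z ∈ B then φ.symm ⟨z, h⟩ else z

theorem extend_extend {A B : Set V} (hAB : A = B ∨ Disjoint A B)
    (φ : X.induce A ≃g X.induce B) (z : V) : extend B A φ.symm (extend A B φ z) = z := by
  by_cases hA : z ∈ A
  · have h1 : extend A B φ z = φ ⟨z, hA⟩ := dif_pos hA
    rw [h1, extend, dif_pos (φ ⟨z, hA⟩).2]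
    exact congrArg Subtype.val (φ.symm_apply_apply ⟨z, hA⟩)
  · by_cases hB : z ∈ B
    · have h1 : extend A B φ z = φ.symm ⟨z, hB⟩ := (dif_neg hA).trans (dif_pos hB)
      have hd : Disjoint A B := hAB.resolve_left fun e => hA (e ▸ hB)
      have h2 : (φ.symm ⟨z, hB⟩).1 ∉ B := Set.disjoint_left.1 hd (φ.symm ⟨z, hB⟩).2
      rw [h1, extend, dif_neg h2, dif_pos (φ.symm ⟨z, hB⟩).2]
      exact congrArg Subtype.val (φ.apply_symm_apply ⟨z, hB⟩)
    · have h1 : extend A B φ z = z := (dif_neg hA).trans (dif_neg hB)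
      rw [h1]
      exact (dif_neg hB).trans (dif_neg hA)

theorem extend_adj {A B : Set V} (hA : ∀ {v w}, X.Adj v w → (v ∈ A ↔ w ∈ A))
    (hB : ∀ {v w}, X.Adj v w → (v ∈ B ↔ w ∈ B))
    (φ : X.induce A ≃g X.induce B) {v w : V} (h : X.Adj v w) :
    X.Adj (extend A B φ v) (extend A B φ w) := by
  by_cases hvA : v ∈ A
  · have hwA := (hA h).1 hvA
    rw [extend, extend, dif_pos hvA, dif_pos hwA]
    exact φ.map_adj_iff (v := ⟨v, hvA⟩) (w := ⟨w, hwA⟩) |>.2 h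
  · have hwA := fun e => hvA ((hA h).2 e)
    by_cases hvB : v ∈ B
    · have hwB := (hB h).1 hvB
      rw [extend, extend, dif_neg hvA, dif_neg hwA, dif_pos hvB, dif_pos hwB]
      exact φ.symm.map_adj_iff (v := ⟨v, hvB⟩) (w := ⟨w, hwB⟩) |>.2 h
    · have hwB := fun e => hvB ((hB h).2 e)
      rwa [extend, extend, dif_neg hvA, dif_neg hwA, dif_neg hvB, dif_neg hwB]

end Extension

theorem mem_autOrbit_iff [Countable V] (hX : DegreeBounded Δ X) (x y : V) :
    y ∈ autOrbit X x ↔ rootedComponent hX x = rootedComponent hX y := by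
  constructor
  · rintro ⟨φ, rfl⟩
    refine Quotient.sound ⟨⟨φ.toEquiv.subtypeEquiv fun v => ?_, ?_⟩, rfl⟩
    · simp only [SimpleGraph.ConnectedComponent.mem_supp_iff, SimpleGraph.ConnectedComponent.eq]
      exact φ.reachable_iff.symm
    · intro v w
      exact φ.map_adj_iff
  · intro h
    obtain ⟨φ, hφ⟩ : RootedIso (X.induce (X.connectedComponentMk x).supp) ⟨x, rfl⟩
      (X.induce (X.connectedComponentMk y).supp) ⟨y, rfl⟩ := Quotient.exact h
    have hadj : ∀ (C : X.ConnectedComponent) {v w}, X.Adj v w → (v ∈ C.supp ↔ w ∈ C.supp) :=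
      fun C v w e => by
        simp only [SimpleGraph.ConnectedComponent.mem_supp_iff]
        rw [SimpleGraph.ConnectedComponent.sound e.reachable]
    have hdis : ∀ C D : X.ConnectedComponent, C.supp = D.supp ∨ Disjoint C.supp D.supp := by
      intro C D
      by_cases hCD : C = D
      · exact Or.inl (by rw [hCD])
      · exact Or.inr (Set.disjoint_left.2 fun v hC hD => hCD (hC.symm.trans hD))
    let F := extend _ _ φ
    let F' := extend _ _ φ.symm
    have h1 : ∀ v, F' (F v) = v := extend_extend (hdis _ _) φ
    have h2 : ∀ v, F (F' v) = v := extend_extend (hdis _ _) φ.symm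
    refine ⟨⟨⟨F, F', h1, h2⟩, ?_⟩, ?_⟩
    · intro v w
      refine ⟨fun e => ?_, fun e => extend_adj (hadj _) (hadj _) φ e⟩
      have e' : X.Adj (F' (F v)) (F' (F w)) := extend_adj (hadj _) (hadj _) φ.symm e
      rwa [h1, h1] at e'
    · have hx : F x = φ ⟨x, rfl⟩ :=
        dif_pos (show x ∈ (X.connectedComponentMk x).supp from rfl)
      exact hx.trans (congrArg Subtype.val hφ)

theorem autOrbit_choose [Countable V] (hX : DegreeBounded Δ X) (x : V)
    (h : rootedComponent hX x ∈ Rcc hX) : autOrbit X h.choose = autOrbit X x := by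
  ext y
  rw [mem_autOrbit_iff hX, mem_autOrbit_iff hX, h.choose_spec]

theorem law_singleton [Finite V] (hX : DegreeBounded Δ X) (x : V) :
    law hX {rootedComponent hX x} =
      ((autOrbit X x).ncard : ENNReal) / (Nat.card V : ENNReal) := by
  have hx : rootedComponent hX x ∈ Rcc hX := ⟨x, rfl⟩
  rw [law, Measure.sum_apply _ (measurableSet_singleton _),
    tsum_eq_single (⟨rootedComponent hX x, hx⟩ : Rcc hX)]
  · simp [autOrbit_choose hX x hx]
  · intro c hc
    have : c.1 ≠ rootedComponent hX x := fun e => hc (Subtype.ext e)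
    simp [this]

theorem law_compl_Rcc [Finite V] (hX : DegreeBounded Δ X) : law hX (Rcc hX)ᶜ = 0 := by
  have hfin : (Rcc hX).Finite := Set.finite_range _
  rw [law, Measure.sum_apply _ hfin.measurableSet.compl]
  simp

instance law_isProbabilityMeasure [Finite V] [Nonempty V] (hX : DegreeBounded Δ X) :
    IsProbabilityMeasure (law hX) := by
  classical
  have := Fintype.ofFinite V
  have hfin : (Rcc hX).Finite := Set.finite_range _
  have hset : (Rcc hX) = ↑(Finset.univ.image (rootedComponent hX)) := by simp [Rcc]
  refine ⟨?_⟩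
  rw [← measure_add_measure_compl hfin.measurableSet, law_compl_Rcc, add_zero, hset,
    ← sum_measure_singleton]
  have hterm : ∀ c ∈ Finset.univ.image (rootedComponent hX), law hX {c} =
      ((Finset.univ.filter fun y => rootedComponent hX y = c).card : ENNReal) /
        (Nat.card V : ENNReal) := by
    intro c hc
    obtain ⟨x, -, rfl⟩ := Finset.mem_image.1 hc
    rw [law_singleton, ← Set.ncard_coe_finset]
    congr 3
    ext y
    rw [mem_autOrbit_iff hX]
    simp [eq_comm]
  rw [Finset.sum_congr rfl hterm]
  simp only [div_eq_mul_inv]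
  have hcard := Finset.card_eq_sum_card_image (rootedComponent hX) Finset.univ
  rw [← Finset.sum_mul, ← Nat.cast_sum, ← hcard, Finset.card_univ, Nat.card_eq_fintype_card]
  exact ENNReal.mul_inv_cancel (by simp) (by simp)

/-- The graph `X \ G`: the subgraph of `X` induced by `V(X) \ V(G)`. -/
abbrev delete (X : SimpleGraph V) (G : X.Subgraph) : SimpleGraph ↥(G.vertsᶜ) :=
  X.induce G.vertsᶜ

theorem DegreeBounded.delete (hX : DegreeBounded Δ X) (G : X.Subgraph) :
    DegreeBounded Δ (delete X G) :=
  hX.induce _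

end Law

/-- The sequence `G` of subgraphs is negligible in the sequence `X` of finite graphs. -/
def Negligible {V : ℕ → Type u} {X : ∀ n, SimpleGraph (V n)} (G : ∀ n, (X n).Subgraph) : Prop :=
  Tendsto (fun n => ((G n).verts.ncard : ℝ) / (Nat.card (V n) : ℝ)) atTop (𝓝 0)

/-- Weak convergence of a sequence of measures on `Gr`. -/
def ConvergesWeakly (μs : ℕ → Measure (Gr.{u} Δ)) (μ : Measure (Gr.{u} Δ)) : Prop :=
  ∀ f : BoundedContinuousFunction (Gr.{u} Δ) ℝ,
    Tendsto (fun n => ∫ a, f a ∂(μs n)) atTop (𝓝 (∫ a, f a ∂μ))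

end GraphLaw

/-! Only a small proportion of vertices can feel the removal of `G n`. A bounded continuous `f` on
`Gr` depends, up to a given error, only on the ball of some fixed radius `r` about the root, because
`Gr` is compact and so `f` is uniformly continuous (`Gr.exists_agree_abs_sub_lt`). A vertex whose
`r`-ball in `X n` misses `G n` has the same `r`-ball after the deletion. Every other vertex lies
within distance `r` of `G n`, and by the degree bound there are at most a constant times `|V(G n)|`
of these. The integral against a law is the average of `f` over the vertices (`integral_law`), so
both integrals are averages of nearly the same numbers (`abs_average_sub_average_le`).

Compactness (`Gr.compactSpace`) comes from an ultralimit. Words over `Fin Δ` name the vertices of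
every rooted graph at once; equality and adjacency of named vertices are decided along an
ultrafilter, and this defines a limit graph. Only finitely many words name the vertices of an
`r`-ball, so almost all graphs share the `r`-ball of the limit. -/

namespace GraphLaw

/-- A marking of the rooted graph `(G, x)` by words over `Fin Δ`: prepending a letter either fixes
the marked vertex or moves it to a neighbour, and every neighbour is reached in this way. -/
structure Marking (Δ : ℕ) {V : Type u} (G : SimpleGraph V) (x : V) where
  toFun : List (Fin Δ) → V
  nil : toFun [] = x
  step : ∀ j w, toFun (j :: w) = toFun w ∨ G.Adj (toFun w) (toFun (j :: w))
  cover : ∀ w v, G.Adj (toFun w) v → ∃ j, toFun (j :: w) = v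

/-! ### Words over `Fin Δ` as names of vertices -/

section Marking

variable {Δ : ℕ} {V W : Type u} {G : SimpleGraph V} {H : SimpleGraph W} {x : V} {y : W}

/-- The first letters enumerate the neighbours; the surplus letters stay at `v`. -/
theorem exists_step (hG : DegreeBounded Δ G) (v : V) :
    ∃ s : Fin Δ → V, (∀ j, s j = v ∨ G.Adj v (s j)) ∧ ∀ w, G.Adj v w → ∃ j, s j = w := by
  have hfin : (G.neighborSet v).Finite :=
    Set.encard_ne_top_iff.1 (ne_top_of_le_ne_top (ENat.natCast_ne_top Δ) (hG v))
  have := hfin.fintype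
  have hcard : Fintype.card (G.neighborSet v) ≤ Δ := by
    have h := hG v
    rw [Set.encard_eq_coe_toFinset_card, Set.toFinset_card] at h
    exact_mod_cast h
  let e := Fintype.equivFin (G.neighborSet v)
  refine ⟨fun j => if h : j.1 < Fintype.card (G.neighborSet v) then (e.symm ⟨j, h⟩).1 else v,
    fun j => ?_, fun w hw => ?_⟩
  · by_cases h : j.1 < Fintype.card (G.neighborSet v)
    · simp only [h, dite_true]
      exact Or.inr (e.symm ⟨j, h⟩).2
    · simp only [h, dite_false, true_or]
  · refine ⟨⟨e ⟨w, hw⟩, (e ⟨w, hw⟩).2.trans_le hcard⟩, ?_⟩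
    simp only [(e ⟨w, hw⟩).2, dite_true, Fin.eta, Equiv.symm_apply_apply]

theorem exists_marking (hG : DegreeBounded Δ G) (x : V) : Nonempty (Marking Δ G x) := by
  choose s hs hc using exists_step hG
  exact ⟨⟨fun w => w.foldr (fun j v => s v j) x, rfl, fun j w => hs _ j, fun w v h => hc _ v h⟩⟩

theorem Marking.mem_ball (m : Marking Δ G x) (w : List (Fin Δ)) :
    m.toFun w ∈ ball G x w.length := by
  induction w with
  | nil => rw [m.nil]; exact root_mem_ball G x _
  | cons j w ih =>
    rcases m.step j w with h | h
    · rw [h]; exact ball_mono (Nat.le_succ _) ih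
    · obtain ⟨p, hp⟩ := mem_ball_iff.1 ih
      exact mem_ball_iff.2 ⟨p.concat h, by simpa using hp⟩

theorem Marking.exists_of_mem_ball (m : Marking Δ G x) {r : ℕ} {v : V} (hv : v ∈ ball G x r) :
    ∃ w : List (Fin Δ), w.length ≤ r ∧ m.toFun w = v := by
  obtain ⟨p, hp⟩ := mem_ball_iff.1 hv
  -- Walks grow at their first edge, so the induction must allow any word as the name of the
  -- starting point.
  suffices h : ∀ {a b : V} (p : G.Walk a b) (w : List (Fin Δ)), m.toFun w = a →
      ∃ w' : List (Fin Δ), w'.length ≤ w.length + p.length ∧ m.toFun w' = b by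
    obtain ⟨w, hw, e⟩ := h p [] m.nil
    exact ⟨w, hw.trans (by simpa using hp), e⟩
  intro a b p
  induction p with
  | nil => exact fun w hw => ⟨w, by simp, hw⟩
  | cons hab p ih =>
    rintro w rfl
    obtain ⟨j, hj⟩ := m.cover w _ hab
    obtain ⟨w', hw', e⟩ := ih (j :: w) hj
    exact ⟨w', by simp only [List.length_cons, SimpleGraph.Walk.length_cons] at *; omega, e⟩

theorem Marking.ball_eq (m : Marking Δ G x) (r : ℕ) :
    ball G x r = m.toFun '' {w | w.length ≤ r} := by
  ext v
  constructor
  · exact fun hv => m.exists_of_mem_ball hv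
  · rintro ⟨w, hw, rfl⟩
    exact ball_mono hw (m.mem_ball w)

/-- Short words name the whole ball, so their coincidences and adjacencies determine it: the
isomorphism sends a vertex to the one with the same name. -/
theorem Marking.ballIso (m : Marking Δ G x) (m' : Marking Δ H y) {r : ℕ}
    (heq : ∀ w w' : List (Fin Δ), w.length ≤ r → w'.length ≤ r →
      (m.toFun w = m.toFun w' ↔ m'.toFun w = m'.toFun w'))
    (hadj : ∀ w w' : List (Fin Δ), w.length ≤ r → w'.length ≤ r →
      (G.Adj (m.toFun w) (m.toFun w') ↔ H.Adj (m'.toFun w) (m'.toFun w'))) :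
    BallIso G x H y r := by
  choose a ha ea using fun v : ball G x r => m.exists_of_mem_ball v.2
  choose b hb eb using fun v : ball H y r => m'.exists_of_mem_ball v.2
  have h0 : ([] : List (Fin Δ)).length ≤ r := Nat.zero_le r
  refine ⟨⟨⟨fun v => ⟨m'.toFun (a v), ball_mono (ha v) (m'.mem_ball _)⟩,
    fun v => ⟨m.toFun (b v), ball_mono (hb v) (m.mem_ball _)⟩, fun v => ?_, fun v => ?_⟩, ?_⟩, ?_⟩
  · refine Subtype.ext (Eq.trans ?_ (ea v))
    exact (heq _ _ (hb _) (ha v)).2 (eb _)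
  · refine Subtype.ext (Eq.trans ?_ (eb v))
    exact (heq _ _ (ha _) (hb v)).1 (ea _)
  · intro v w
    have := hadj _ _ (ha v) (ha w)
    rw [ea, ea] at this
    exact this.symm
  · refine Subtype.ext (Eq.trans ?_ m'.nil)
    exact (heq _ _ (ha _) h0).1 ((ea _).trans m.nil.symm)

/-- What matters is that the bound is the same for all graphs and all roots. -/
theorem ncard_ball_le (hG : DegreeBounded Δ G) (x : V) (r : ℕ) :
    (ball G x r).ncard ≤ {w : List (Fin Δ) | w.length ≤ r}.ncard := by
  obtain ⟨m⟩ := exists_marking hG x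
  rw [m.ball_eq r]
  exact Set.ncard_image_le (List.finite_length_le _ r)

end Marking

/-! ### Ultralimits of marked graphs -/

section Limit

variable {Δ : ℕ} {ι : Type*} (U : Ultrafilter ι) (X : ι → RootedGraph.{u} Δ)
  (m : ∀ i, Marking Δ (X i).graph (X i).root)

/-- Two words are identified if they mark the same vertex in almost all graphs. -/
def limitSetoid : Setoid (List (Fin Δ)) where
  r w w' := ∀ᶠ i in (U : Filter ι), (m i).toFun w = (m i).toFun w'
  iseqv :=
    { refl := fun _ => Eventually.of_forall fun _ => rfl
      symm := fun h => h.mono fun _ e => e.symm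
      trans := fun h k => (h.and k).mono fun _ e => e.1.trans e.2 }

/-- The vertices of the limit along `U` of marked graphs. -/
def LimitVertex : Type u := ULift.{u} (Quotient (limitSetoid U X m))

/-- The vertex of the limit marked by a word. -/
def limitMk (w : List (Fin Δ)) : LimitVertex U X m := ⟨Quotient.mk _ w⟩

theorem limitMk_eq_iff {w w' : List (Fin Δ)} : limitMk U X m w = limitMk U X m w' ↔
    ∀ᶠ i in (U : Filter ι), (m i).toFun w = (m i).toFun w' := by
  exact ULift.up_inj.trans Quotient.eq

theorem limitMk_surjective : Function.Surjective (limitMk U X m) := by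
  rintro ⟨v⟩
  induction v using Quotient.inductionOn with | h w => exact ⟨w, rfl⟩

/-- The limit along `U` of marked graphs. -/
def limitGraph : SimpleGraph (LimitVertex U X m) where
  Adj v v' := ∃ w w', limitMk U X m w = v ∧ limitMk U X m w' = v' ∧
    ∀ᶠ i in (U : Filter ι), (X i).graph.Adj ((m i).toFun w) ((m i).toFun w')
  symm := ⟨by
    rintro v v' ⟨w, w', h, h', e⟩
    exact ⟨w', w, h', h, e.mono fun _ => SimpleGraph.Adj.symm⟩⟩
  loopless := ⟨by
    rintro v ⟨w, w', h, h', e⟩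
    obtain ⟨i, hi, k⟩ := (((limitMk_eq_iff U X m).1 (h.trans h'.symm)).and e).exists
    rw [hi] at k
    exact k.ne rfl⟩

theorem limitGraph_adj_iff {w w' : List (Fin Δ)} :
    (limitGraph U X m).Adj (limitMk U X m w) (limitMk U X m w') ↔
      ∀ᶠ i in (U : Filter ι), (X i).graph.Adj ((m i).toFun w) ((m i).toFun w') := by
  constructor
  · rintro ⟨a, a', h, h', e⟩
    filter_upwards [(limitMk_eq_iff U X m).1 h, (limitMk_eq_iff U X m).1 h', e] with i k k' e
    rwa [← k, ← k']
  · exact fun h => ⟨w, w', rfl, rfl, h⟩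

/-- The limit is marked by the same words. -/
def limitMarking : Marking Δ (limitGraph U X m) (limitMk U X m []) where
  toFun := limitMk U X m
  nil := rfl
  step j w := by
    rw [limitMk_eq_iff, limitGraph_adj_iff, ← Ultrafilter.eventually_or]
    exact Eventually.of_forall fun i => (m i).step j w
  cover w v h := by
    obtain ⟨w', rfl⟩ := limitMk_surjective U X m v
    simp only [limitMk_eq_iff]
    -- The letter that reaches the neighbour varies with `i`, but there are finitely many letters,
    -- so a single one works almost everywhere.
    refine Ultrafilter.eventually_exists_iff.1 ?_
    exact ((limitGraph_adj_iff U X m).1 h).mono fun i hi => (m i).cover w _ hi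

theorem limitGraph_connected : (limitGraph U X m).Connected := by
  have h : ∀ v, (limitGraph U X m).Reachable (limitMk U X m []) v := by
    intro v
    obtain ⟨w, rfl⟩ := limitMk_surjective U X m v
    obtain ⟨p, -⟩ := mem_ball_iff.1 ((limitMarking U X m).mem_ball w)
    exact ⟨p⟩
  have : Nonempty (LimitVertex U X m) := ⟨limitMk U X m []⟩
  exact ⟨fun v w => (h v).symm.trans (h w)⟩

theorem limitGraph_degreeBounded : DegreeBounded Δ (limitGraph U X m) := by
  intro v
  obtain ⟨w, rfl⟩ := limitMk_surjective U X m v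
  have hsub : (limitGraph U X m).neighborSet (limitMk U X m w) ⊆
      (fun j => limitMk U X m (j :: w)) '' Set.univ := by
    intro v hv
    obtain ⟨j, hj⟩ := (limitMarking U X m).cover w v hv
    exact ⟨j, trivial, hj⟩
  refine (Set.encard_le_encard hsub).trans ((Set.encard_image_le _ _).trans ?_)
  simp

/-- The limit of marked graphs as a rooted graph. -/
def limitRooted : RootedGraph.{u} Δ where
  V := LimitVertex U X m
  countable := (limitMk_surjective U X m).countable
  graph := limitGraph U X m
  root := limitMk U X m []
  connected := limitGraph_connected U X m
  degree_le := limitGraph_degreeBounded U X m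

/-- Finitely many equalities and adjacencies between words of length at most `r` describe the ball,
and the ultrafilter decides each of them as the limit does. -/
theorem eventually_ballIso_limit (r : ℕ) : ∀ᶠ i in (U : Filter ι),
    BallIso (X i).graph (X i).root (limitGraph U X m) (limitMk U X m []) r := by
  have key : ∀ P : ι → Prop, ∀ᶠ i in (U : Filter ι), (P i ↔ ∀ᶠ j in (U : Filter ι), P j) := by
    intro P
    by_cases h : ∀ᶠ j in (U : Filter ι), P j
    · exact h.mono fun i hi => iff_of_true hi h
    · exact (Ultrafilter.eventually_not.2 h).mono fun i hi => iff_of_false hi h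
  have hfin : {w : List (Fin Δ) | w.length ≤ r}.Finite := List.finite_length_le _ r
  have h1 := (hfin.eventually_all (l := (U : Filter ι))).2 fun w _ =>
    (hfin.eventually_all (l := (U : Filter ι))).2 fun w' _ =>
      (key fun i => (m i).toFun w = (m i).toFun w').and
        (key fun i => (X i).graph.Adj ((m i).toFun w) ((m i).toFun w'))
  filter_upwards [h1] with i hi
  refine (m i).ballIso (limitMarking U X m) (fun w w' hw hw' => ?_) fun w w' hw hw' => ?_
  · exact (hi w hw w' hw').1.trans (limitMk_eq_iff U X m).symm
  · exact (hi w hw w' hw').2.trans (limitGraph_adj_iff U X m).symm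

end Limit

/-! ### Compactness of `Gr` and uniform continuity -/

section Compactness

variable {Δ : ℕ}

theorem Gr.dist_lt_of_agree {a b : Gr.{u} Δ} {r : ℕ} {ε : ℝ} (hr : (1 / 2 : ℝ) ^ r < ε)
    (h : a.Agree b r) : dist a b < ε := by
  refine lt_of_le_of_lt ?_ hr
  change a.rho b ≤ _
  unfold Gr.rho
  split_ifs with hab
  · positivity
  · have : r ≤ sSup {s : ℕ | a.Agree b s} := le_csSup (Gr.bddAbove_agree hab) h
    rw [zpow_neg, zpow_natCast, one_div, inv_pow]
    gcongr
    exact one_le_two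

theorem Gr.exists_dist_lt_of_agree {ε : ℝ} (hε : 0 < ε) :
    ∃ r : ℕ, ∀ a b : Gr.{u} Δ, a.Agree b r → dist a b < ε := by
  obtain ⟨r, hr⟩ := exists_pow_lt_of_lt_one hε (by norm_num : (1 / 2 : ℝ) < 1)
  exact ⟨r, fun a b => Gr.dist_lt_of_agree hr⟩

instance Gr.compactSpace : CompactSpace (Gr.{u} Δ) := by
  refine ⟨isCompact_iff_ultrafilter_le_nhds.2 fun U _ => ?_⟩
  -- The ultrafilter lives on `Gr` itself, so the family whose ultralimit is taken is indexed by
  -- `Gr`, each class giving a marked representative.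
  have m : ∀ a : Gr.{u} Δ, Marking Δ (Quotient.out a).graph (Quotient.out a).root := fun a =>
    (exists_marking (Quotient.out a).degree_le _).some
  refine ⟨Quotient.mk _ (limitRooted U Quotient.out m), trivial, ?_⟩
  refine Metric.nhds_basis_ball.ge_iff.2 fun ε hε => ?_
  obtain ⟨r, hr⟩ := Gr.exists_dist_lt_of_agree (Δ := Δ) hε
  filter_upwards [eventually_ballIso_limit U Quotient.out m r] with a ha
  refine hr _ _ ?_
  rw [← Quotient.out_eq a]
  exact ha

theorem Gr.exists_agree_abs_sub_lt (f : BoundedContinuousFunction (Gr.{u} Δ) ℝ) {ε : ℝ}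
    (hε : 0 < ε) : ∃ r : ℕ, ∀ a b : Gr.{u} Δ, a.Agree b r → |f a - f b| < ε := by
  obtain ⟨δ, hδ, h⟩ := Metric.uniformContinuous_iff.1
    (CompactSpace.uniformContinuous_of_continuous f.continuous) ε hε
  obtain ⟨r, hr⟩ := Gr.exists_dist_lt_of_agree (Δ := Δ) hδ
  exact ⟨r, fun a b hab => h (hr a b hab)⟩

end Compactness

/-! ### Locality of balls, and laws as vertex averages -/

section LawIntegral

variable {Δ : ℕ} {V : Type u} {X : SimpleGraph V}

/-- A walk of length at most `r` from `x` never leaves the ball, hence survives in `A`. -/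
theorem ball_induce {A : Set V} {x : V} {r : ℕ} (h : ball X x r ⊆ A) (hx : x ∈ A) (v : A) :
    v ∈ ball (X.induce A) ⟨x, hx⟩ r ↔ v.1 ∈ ball X x r := by
  classical
  rw [mem_ball_iff, mem_ball_iff]
  constructor
  · rintro ⟨p, hp⟩
    exact ⟨p.map (SimpleGraph.Embedding.induce (G := X) A).toHom,
      (SimpleGraph.Walk.length_map _ _).le.trans hp⟩
  · rintro ⟨p, hp⟩
    have hs : ∀ w ∈ p.support, w ∈ A := fun w hw =>
      h (mem_ball_iff.2 ⟨p.takeUntil w hw, (p.length_takeUntil_le_length hw).trans hp⟩)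
    refine ⟨p.induce _ hs, ?_⟩
    have := congrArg SimpleGraph.Walk.length (p.map_induce hs)
    rw [SimpleGraph.Walk.length_map] at this
    exact this.le.trans hp

theorem ballIso_induce {A : Set V} {x : V} {r : ℕ} (h : ball X x r ⊆ A) (hx : x ∈ A) :
    BallIso (X.induce A) ⟨x, hx⟩ X x r := by
  refine ⟨⟨⟨fun v => ⟨v.1.1, (ball_induce h hx v.1).1 v.2⟩,
    fun v => ⟨⟨v.1, h v.2⟩, (ball_induce h hx _).2 v.2⟩, fun v => rfl, fun v => rfl⟩, ?_⟩, rfl⟩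
  intro v w
  exact Iff.rfl

theorem ballIso_component [Countable V] (hX : DegreeBounded Δ X) (x : V) (r : ℕ) :
    BallIso (component hX x).graph (component hX x).root X x r := by
  refine ballIso_induce (fun v hv => ?_) _
  obtain ⟨p, -⟩ := mem_ball_iff.1 hv
  exact SimpleGraph.ConnectedComponent.sound p.reachable.symm

theorem agree_rootedComponent_induce [Countable V] (hX : DegreeBounded Δ X) {A : Set V} {x : V}
    {r : ℕ} (h : ball X x r ⊆ A) (hx : x ∈ A) :
    (rootedComponent hX x).Agree (rootedComponent (hX.induce A) ⟨x, hx⟩) r :=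
  (ballIso_component hX x r).trans
    (((ballIso_component (hX.induce A) ⟨x, hx⟩ r).trans (ballIso_induce h hx)).symm)

/-- Orbits are the fibres of `rootedComponent`, so an atom weighs as much as its share of the
vertices. For empty `V` both sides are `0`. -/
theorem integral_law [Fintype V] (hX : DegreeBounded Δ X)
    (f : BoundedContinuousFunction (Gr.{u} Δ) ℝ) :
    ∫ a, f a ∂(law hX) = (∑ x, f (rootedComponent hX x)) / Fintype.card V := by
  classical
  have : Finite (Rcc hX) := (Set.finite_range _).to_subtype
  have := Fintype.ofFinite (Rcc hX)
  rw [law, Measure.sum_fintype, integral_finsetSum_measure]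
  · rw [← Finset.sum_fiberwise Finset.univ
      (fun x => (⟨rootedComponent hX x, x, rfl⟩ : Rcc hX)), Finset.sum_div]
    refine Finset.sum_congr rfl fun c _ => ?_
    have hc : (autOrbit X c.2.choose).ncard =
        (Finset.univ.filter fun x => (⟨rootedComponent hX x, x, rfl⟩ : Rcc hX) = c).card := by
      rw [← Set.ncard_coe_finset]
      congr 1
      ext y
      rw [mem_autOrbit_iff hX, c.2.choose_spec]
      simp [Subtype.ext_iff, eq_comm]
    have hs : ∀ x ∈ Finset.univ.filter
        (fun x => (⟨rootedComponent hX x, x, rfl⟩ : Rcc hX) = c),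
        f (rootedComponent hX x) = f c.1 := by
      intro x hx
      rw [← (Finset.mem_filter.1 hx).2]
    rw [Finset.sum_congr rfl hs, integral_smul_measure, integral_dirac, hc]
    simp only [Finset.sum_const, nsmul_eq_mul, ENNReal.toReal_div, ENNReal.toReal_natCast,
      smul_eq_mul, Nat.card_eq_fintype_card]
    ring
  · intro c _
    refine Integrable.smul_measure ?_ ?_
    · exact f.integrable _
    · have : Nonempty V := ⟨c.2.choose⟩
      exact ENNReal.div_ne_top (by simp) (by simp)

end LawIntegral

/-- Comparison of the averages of `F` over a finite type and of `F'` over a subset of it. -/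
theorem abs_average_sub_average_le {V : Type*} [Fintype V] [Nonempty V] (s : Set V) [Fintype ↥sᶜ]
    (F : V → ℝ) (F' : ↥sᶜ → ℝ) {K ε : ℝ} (hε : 0 ≤ ε) (b : Set V) (hF : ∀ x, |F x| ≤ K)
    (hF' : ∀ x, |F' x| ≤ K) (h : ∀ x : ↥sᶜ, x.1 ∉ b → |F x - F' x| ≤ ε) :
    |(∑ x, F x) / Fintype.card V - (∑ x, F' x) / Fintype.card ↥sᶜ| ≤
      ε + 2 * K * ((s.ncard + b.ncard) / Fintype.card V) := by
  classical
  have hK : 0 ≤ K := (abs_nonneg _).trans (hF (Classical.arbitrary V))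
  have hN : (0 : ℝ) < Fintype.card V := by exact_mod_cast Fintype.card_pos
  have hcard : (s.ncard : ℝ) + Fintype.card ↥sᶜ = Fintype.card V := by
    have := Set.ncard_add_ncard_compl s
    rw [← Nat.card_coe_set_eq sᶜ, Nat.card_eq_fintype_card, Nat.card_eq_fintype_card] at this
    exact_mod_cast this
  have hMN : (Fintype.card ↥sᶜ : ℝ) ≤ Fintype.card V := by
    rw [← hcard]; simp
  have hsum : ∑ x, F x = (∑ x ∈ s.toFinset, F x) + ∑ x : ↥sᶜ, F x := by
    rw [← Finset.sum_add_sum_compl s.toFinset]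
    congr 1
    exact Finset.sum_subtype _ (fun x => by simp) F
  have h1 : |∑ x ∈ s.toFinset, F x| ≤ s.ncard * K := by
    refine (Finset.abs_sum_le_sum_abs _ _).trans ((Finset.sum_le_card_nsmul _ _ K
      fun x _ => hF x).trans ?_)
    rw [Set.ncard_eq_toFinset_card', nsmul_eq_mul]
  have h2 : |∑ x : ↥sᶜ, F x - ∑ x, F' x| ≤ Fintype.card V * ε + b.ncard * (2 * K) := by
    rw [← Finset.sum_sub_distrib]
    refine (Finset.abs_sum_le_sum_abs _ _).trans ?_
    have hterm : ∀ x : ↥sᶜ, |F x - F' x| ≤ ε + if x.1 ∈ b then 2 * K else 0 := by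
      intro x
      split_ifs with hx
      · have := abs_sub (F x) (F' x)
        linarith [hF x, hF' x]
      · simpa using h x hx
    refine (Finset.sum_le_sum fun x _ => hterm x).trans ?_
    rw [Finset.sum_add_distrib, Finset.sum_const, Finset.card_univ, nsmul_eq_mul]
    refine add_le_add (mul_le_mul_of_nonneg_right hMN hε) ?_
    rw [← Finset.sum_filter, Finset.sum_const, nsmul_eq_mul]
    refine mul_le_mul_of_nonneg_right ?_ (by positivity)
    rw [Set.ncard_eq_toFinset_card', Nat.cast_le]
    refine Finset.card_le_card_of_injOn Subtype.val (fun x hx => ?_) Subtype.val_injective.injOn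
    simpa using hx
  have h3 : |(∑ x, F' x) / Fintype.card V - (∑ x, F' x) / Fintype.card ↥sᶜ| ≤
      s.ncard * K / Fintype.card V := by
    -- If everything is deleted, the second average is `0 / 0 = 0`, in accordance with the zero law.
    rcases isEmpty_or_nonempty ↥sᶜ with he | he
    · simp; positivity
    · have hM : (0 : ℝ) < Fintype.card ↥sᶜ := by exact_mod_cast Fintype.card_pos
      have hS : |∑ x, F' x| ≤ Fintype.card ↥sᶜ * K := by
        refine (Finset.abs_sum_le_sum_abs _ _).trans ((Finset.sum_le_card_nsmul _ _ K
          fun x _ => hF' x).trans ?_)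
        rw [nsmul_eq_mul, Finset.card_univ]
      have e : (∑ x, F' x) / Fintype.card V - (∑ x, F' x) / Fintype.card ↥sᶜ =
          -((∑ x, F' x) * (s.ncard / (Fintype.card V * Fintype.card ↥sᶜ))) := by
        field_simp
        rw [← hcard]
        ring
      rw [e, abs_neg, abs_mul, abs_of_nonneg (by positivity : (0 : ℝ) ≤
        s.ncard / (Fintype.card V * Fintype.card ↥sᶜ))]
      refine (mul_le_mul_of_nonneg_right hS (by positivity)).trans (le_of_eq ?_)
      field_simp
  have h4 : |(∑ x, F x) / Fintype.card V - (∑ x, F' x) / Fintype.card V| ≤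
      (s.ncard * K + (Fintype.card V * ε + b.ncard * (2 * K))) / Fintype.card V := by
    rw [← sub_div, abs_div, abs_of_pos hN, hsum, add_sub_assoc]
    exact div_le_div_of_nonneg_right ((abs_add_le _ _).trans (add_le_add h1 h2)) hN.le
  -- The factor `2 * K` on `s.ncard` is one `K` for the dropped terms and one for the changed
  -- denominator; on `b.ncard` it bounds `|F x - F' x|`.
  refine (abs_sub_le _ _ _).trans ((add_le_add h4 h3).trans (le_of_eq ?_))
  field_simp
  ring

/-! ### The error bound for a single deletion, and the theorem -/

theorem ncard_biUnion_ball_le {Δ : ℕ} {V : Type u} [Finite V] {X : SimpleGraph V}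
    (hX : DegreeBounded Δ X) (s : Set V) (r : ℕ) :
    (⋃ y ∈ s, ball X y r).ncard ≤ s.ncard * {w : List (Fin Δ) | w.length ≤ r}.ncard := by
  classical
  have := Fintype.ofFinite V
  have e : (⋃ y ∈ s, ball X y r) = ↑(s.toFinset.biUnion fun y => (ball X y r).toFinset) := by
    ext; simp
  rw [e, Set.ncard_coe_finset, Set.ncard_eq_toFinset_card' s]
  refine Finset.card_biUnion_le_card_mul _ _ _ fun y _ => ?_
  rw [← Set.ncard_eq_toFinset_card']
  exact ncard_ball_le hX y r

theorem abs_integral_law_sub_delete_le {Δ : ℕ} (f : BoundedContinuousFunction (Gr.{u} Δ) ℝ)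
    {r : ℕ} {ε : ℝ} (hε : 0 < ε) (hr : ∀ a b : Gr.{u} Δ, a.Agree b r → |f a - f b| < ε)
    {V : Type u} [Finite V] [Nonempty V] {X : SimpleGraph V} (hX : DegreeBounded Δ X)
    (G : X.Subgraph) :
    |∫ a, f a ∂(law hX) - ∫ a, f a ∂(law (hX.delete G))| ≤
      ε + 2 * ‖f‖ * (1 + {w : List (Fin Δ) | w.length ≤ r}.ncard) *
        (G.verts.ncard / Nat.card V) := by
  classical
  have := Fintype.ofFinite V
  rw [integral_law, integral_law]
  refine (abs_average_sub_average_le G.verts (fun x => f (rootedComponent hX x))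
    (fun x => f (rootedComponent (hX.delete G) x)) hε.le (⋃ y ∈ G.verts, ball X y r)
    (fun x => f.norm_coe_le_norm _) (fun x => f.norm_coe_le_norm _) ?_).trans ?_
  · intro x hx
    -- By symmetry of the distance, a deleted vertex in the ball about `x` would put `x` in a ball
    -- about a deleted vertex.
    have hsub : ball X x.1 r ⊆ G.vertsᶜ := fun v hv hvG => hx ?_
    · exact (hr _ _ (agree_rootedComponent_induce hX hsub x.2)).le
    refine Set.mem_biUnion hvG ?_
    change X.edist v x ≤ r
    rw [SimpleGraph.edist_comm]
    exact hv
  · rw [Nat.card_eq_fintype_card, mul_assoc (2 * ‖f‖), ← mul_div_assoc (1 + _)]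
    gcongr
    have h : ((⋃ y ∈ G.verts, ball X y r).ncard : ℝ) ≤
        G.verts.ncard * {w : List (Fin Δ) | w.length ≤ r}.ncard := by
      exact_mod_cast ncard_biUnion_ball_le hX G.verts r
    linarith

end GraphLaw

theorem mainTheorem5 (Δ : ℕ) (hΔ : 0 < Δ) (V : ℕ → Type u) [∀ n, Finite (V n)]
    [∀ n, Nonempty (V n)] (X : ∀ n, SimpleGraph (V n))
    (hX : ∀ n, GraphLaw.DegreeBounded Δ (X n)) (G : ∀ n, (X n).Subgraph)
    (hG : GraphLaw.Negligible G) :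
    (∀ f : BoundedContinuousFunction (GraphLaw.Gr.{u} Δ) ℝ,
      Tendsto (fun n => |∫ a, f a ∂(GraphLaw.law (hX n)) -
        ∫ a, f a ∂(GraphLaw.law ((hX n).delete (G n)))|) atTop (𝓝 0)) ∧
    (∀ μ : Measure (GraphLaw.Gr.{u} Δ), IsProbabilityMeasure μ →
      (GraphLaw.ConvergesWeakly (fun n => GraphLaw.law (hX n)) μ ↔
        GraphLaw.ConvergesWeakly (fun n => GraphLaw.law ((hX n).delete (G n))) μ)) := by
  -- The signed difference tends to `0`; adding or subtracting it transfers weak limits in either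
  -- direction.
  have key : ∀ f : BoundedContinuousFunction (GraphLaw.Gr.{u} Δ) ℝ,
      Tendsto (fun n => ∫ a, f a ∂(GraphLaw.law (hX n)) -
        ∫ a, f a ∂(GraphLaw.law ((hX n).delete (G n)))) atTop (𝓝 0) := by
    intro f
    refine Metric.tendsto_nhds.2 fun ε hε => ?_
    obtain ⟨r, hr⟩ := GraphLaw.Gr.exists_agree_abs_sub_lt f (half_pos hε)
    -- The radius `r` depends on `f` and `ε` alone, so the factor in front of the vanishing ratio
    -- does not vary with `n`.
    have hlim := (Tendsto.const_mul
      (2 * ‖f‖ * (1 + ({w : List (Fin Δ) | w.length ≤ r}.ncard : ℝ))) hG).const_add (ε / 2)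
    rw [mul_zero, add_zero] at hlim
    filter_upwards [hlim.eventually_lt_const (half_lt_self hε)] with n hn
    rw [dist_zero_right, Real.norm_eq_abs]
    exact (GraphLaw.abs_integral_law_sub_delete_le f (half_pos hε) hr (hX n) (G n)).trans_lt hn
  refine ⟨fun f => by simpa using (key f).abs, fun μ _ => forall_congr' fun f => ?_⟩
  exact ⟨fun h => by simpa using h.sub (key f), fun h => by simpa using h.add (key f)⟩
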